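/- Let $\kappa,n\ge 0$ be integers. For two $n$-bit block ciphers $E^1,E^2$ with $\kappa$-bit keys (families $(E^j_i)_{i\in\{0,1\}^\kappa}$ of permutations of $\{0,1\}^n$), a key $k\in\{0,1\}^\kappa$ and whitening keys $k_1,k_2\in\{0,1\}^n$, let $$\mathsf{EFX}_{k,k_1,k_2}(x)=E^2_k\bigl(k_2\oplus E^1_k(k_1\oplus x)\bigr),\qquad x\in\{0,1\}^n .$$ In the sPRP game, $E^1,E^2$ are independent and uniformly random. A classical, adaptive, randomized, computationally unbounded adversary $\mathcal A$ has access to the oracles $(j,i,a)\mapsto E^j_i(a)$ and $(j,i,b)\mapsto (E^j_i)^{-1}(b)$ (offline queries), and to the forward and backward directions of an encryption oracle (online queries), which is $\mathsf{EFX}_{k,k_1,k_2}$ with uniformly random secret $k,k_1,k_2$ in the real world and an independent uniformly random permutation $p$ of $\{0,1\}^n$ in the ideal world. Finally $\mathcal A$ outputs a bit, and $$\mathrm{Adv}^{\mathrm{sprp}}(\mathcal A)=\Pr[\mathcal A\to 1\text{ in the real world}]-\Pr[\mathcal A\to 1\text{ in the ideal world}].$$ Queries are counted as distinct input/output pairs: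 a repeated query, or the inverse of an earlier one, is not counted again. Then for every $\delta>0$ there is a constant $c>0$, depending only on $\delta$, such that for all $\kappa,n,D,T$ and every such adversary $\mathcal A$ that makes at most $D$ online and at most $T$ offline queries in every interaction, if $\mathrm{Adv}^{\mathrm{sprp}}(\mathcal A)\ge\delta$, then both $$D\,T\ \ge\ c\,2^{\kappa+n}\qquad\text{and}\qquad T\ \ge\ c\,2^{\kappa+n/2}.$$ In particular, if $\kappa=2n$, then $T\ge c\,2^{5n/2}$, so that the work of $\mathcal A$ is at least $c\,2^{5n/2}$. -/

import Mathlib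

namespace EFXGame

/-- An `n`-bit block cipher with `κ`-bit keys: a family of permutations of `{0,1}ⁿ` indexed by
`{0,1}^κ`. -/
abbrev BlockCipher (κ n : ℕ) : Type := BitVec κ → Equiv.Perm (BitVec n)

noncomputable instance (κ n : ℕ) : Fintype (BlockCipher κ n) := Fintype.ofFinite _

/-- Whitening with the key `z`, as a permutation of `{0,1}ⁿ`. -/
def xorPerm {n : ℕ} (z : BitVec n) : Equiv.Perm (BitVec n) where
  toFun x := z ^^^ x
  invFun x := z ^^^ x
  left_inv x := by simp
  right_inv x := by simp

/-- A pair of block ciphers; `E 0` and `E 1` are the first and the second cipher. -/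
abbrev CipherPair (κ n : ℕ) : Type := Fin 2 → BlockCipher κ n

/-- The extended FX construction, as a permutation of `{0,1}ⁿ`. -/
def efx {κ n : ℕ} (E : CipherPair κ n) (k : BitVec κ) (k₁ k₂ : BitVec n) :
    Equiv.Perm (BitVec n) :=
  (xorPerm k₁).trans ((E 0 k).trans ((xorPerm k₂).trans (E 1 k)))

theorem efx_apply {κ n : ℕ} (E : CipherPair κ n) (k : BitVec κ) (k₁ k₂ x : BitVec n) :
    efx E k k₁ k₂ x = E 1 k (k₂ ^^^ E 0 k (k₁ ^^^ x)) := rfl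

/-- The oracle queries of the game: forward and backward queries to the encryption oracle
(online), and forward and backward queries to either cipher under a key of the adversary's
choice (offline). -/
inductive Query (κ n : ℕ) : Type
  | enc (x : BitVec n)
  | dec (y : BitVec n)
  | cipher (j : Fin 2) (i : BitVec κ) (a : BitVec n)
  | cipherInv (j : Fin 2) (i : BitVec κ) (b : BitVec n)

/-- The answer to a query when the ciphers are `E` and the encryption oracle is `p`. -/
def Query.answer {κ n : ℕ} (E : CipherPair κ n) (p : Equiv.Perm (BitVec n)) :
    Query κ n → BitVec n
  | enc x => p x
  | dec y => p.symm y
  | cipher j i a => E j i a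
  | cipherInv j i b => (E j i).symm b

/-- The element of `𝒳` contributed by a query: the input of an encryption query, the output of a
decryption query. -/
def Query.online {κ n : ℕ} (p : Equiv.Perm (BitVec n)) : Query κ n → Finset (BitVec n)
  | enc x => {x}
  | dec y => {p.symm y}
  | cipher _ _ _ => ∅
  | cipherInv _ _ _ => ∅

/-- The element contributed by a query to the sets `𝒬ʲᵢ`, tagged with `j` and `i`: the input of a
forward cipher query, the output of a backward cipher query. -/
def Query.offline {κ n : ℕ} (E : CipherPair κ n) :
    Query κ n → Finset (Fin 2 × BitVec κ × BitVec n)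
  | enc _ => ∅
  | dec _ => ∅
  | cipher j i a => {(j, i, a)}
  | cipherInv j i b => {(j, i, (E j i).symm b)}

/-- A deterministic, adaptive, computationally unbounded strategy: either stop with an output
bit, or ask a query and continue depending on the answer. -/
inductive Strategy (κ n : ℕ) : Type
  | output (b : Bool)
  | ask (q : Query κ n) (next : BitVec n → Strategy κ n)

namespace Strategy

variable {κ n : ℕ} (E : CipherPair κ n) (p : Equiv.Perm (BitVec n))

/-- The output bit of the strategy when it interacts with the oracles `E` and `p`. -/
def run : Strategy κ n → Bool
  | output b => b
  | ask q next => (next (q.answer E p)).run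

/-- The set `𝒳` of the interaction with the oracles `E` and `p`. -/
def onlineSet : Strategy κ n → Finset (BitVec n)
  | output _ => ∅
  | ask q next => q.online p ∪ (next (q.answer E p)).onlineSet

/-- The disjoint union of the sets `𝒬ʲᵢ` of the interaction with the oracles `E` and `p`. -/
def offlineSet : Strategy κ n → Finset (Fin 2 × BitVec κ × BitVec n)
  | output _ => ∅
  | ask q next => q.offline E ∪ (next (q.answer E p)).offlineSet

end Strategy

/-- A randomized adversary: a probability distribution on deterministic strategies. -/
abbrev Adversary (κ n : ℕ) : Type := PMF (Strategy κ n)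

namespace Adversary

variable {κ n : ℕ}

/-- In every interaction, `A` makes at most `D` online and `T` offline queries (repetitions of a
query, and inverses of earlier queries, are not counted again). -/
def MakesAtMost (A : Adversary κ n) (D T : ℕ) : Prop :=
  ∀ s ∈ A.support, ∀ (E : CipherPair κ n) (p : Equiv.Perm (BitVec n)),
    (s.onlineSet E p).card ≤ D ∧ (s.offlineSet E p).card ≤ T

/-- The distribution of the output bit in the real world: two independent ideal ciphers, uniform
keys `k, k₁, k₂`, and EFX as the encryption oracle. -/
noncomputable def realWorld (A : Adversary κ n) : PMF Bool :=
  (PMF.uniformOfFintype (CipherPair κ n)).bind fun E =>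
    (PMF.uniformOfFintype (BitVec κ × BitVec n × BitVec n)).bind fun key =>
      A.map fun s => s.run E (efx E key.1 key.2.1 key.2.2)

/-- The distribution of the output bit in the ideal world: two independent ideal ciphers and an
independent uniform permutation as the encryption oracle. -/
noncomputable def idealWorld (A : Adversary κ n) : PMF Bool :=
  (PMF.uniformOfFintype (CipherPair κ n)).bind fun E =>
    (PMF.uniformOfFintype (Equiv.Perm (BitVec n))).bind fun p =>
      A.map fun s => s.run E p

/-- The sPRP advantage of `A` against EFX. -/
noncomputable def advantage (A : Adversary κ n) : ℝ :=
  (A.realWorld true).toReal - (A.idealWorld true).toReal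

end Adversary

end EFXGame

/-! Both bounds compare the worlds for a deterministic strategy and fixed keys `k`, `k₁`, `k₂`;
randomized adversaries follow by averaging (`advantage_le`). The real world is the diagonal `q = f`
of a game with two permutations, and the ideal world has `f`, `q` independent. By
`card_diagonal_le`, the acceptance probability on the diagonal exceeds the independent one by at
most the probability, in the independent game, that points visited by `f` and by `q` collide at
inputs or at outputs. This is used twice. With the second cipher fixed, `q` stands for the first
cipher inside the encryption oracle, and collisions pair first-cipher queries with online queries.
With the oracle `p` fixed, `q` stands for the first cipher inside the second, and collisions pair
queries to the two ciphers. For fixed `E`, `p` the visited sets do not depend on the keys, so a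
union bound over `k₁`, `k₂` applies. Summing over `k` gives advantage at most `2DT / 2^(κ+n)` in the
first case. In the second, interpolating with the trivial bound gives `T / 2^(κ+n/2)`. -/

namespace EFXGame

open Equiv Finset

/-! ### Counting permutations with prescribed values -/

/-- The permutations that agree with `f` on `A` number `(|V| - |A|)!`. -/
theorem card_perm_eqOn {V : Type*} [Fintype V] [DecidableEq V] (f : Perm V) (A : Finset V) :
    #{g : Perm V | ∀ a ∈ A, g a = f a} = (Fintype.card V - #A).factorial := by
  have e : {g : Perm V // ∀ a ∈ A, g a = f a} ≃ Perm {a // a ∉ A} :=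
    ((Equiv.mulLeft f⁻¹).subtypeEquiv fun g => by
      refine forall_congr' fun a => ?_
      simp only [Equiv.coe_mulLeft, Perm.mul_apply, Perm.inv_eq_iff_eq, not_not]).trans
      (Perm.subtypeEquivSubtypePerm (fun a => a ∉ A)).symm
  rw [← Fintype.card_subtype, Fintype.card_congr e, Fintype.card_perm]
  congr 1
  simp [Fintype.card_subtype_compl]

/-- Two permutations restricted to disjoint sets with disjoint images have a common extension. -/
theorem exists_perm_extend {V : Type*} [Fintype V] [DecidableEq V] (f q : Perm V)
    (A X : Finset V) (h₁ : Disjoint A X) (h₂ : Disjoint (A.image f) (X.image q)) :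
    ∃ g : Perm V, (∀ a ∈ A, g a = f a) ∧ ∀ x ∈ X, g x = q x := by
  let F : V → V := fun v => if v ∈ A then f v else q v
  have hX : ∀ x ∈ X, F x = q x := fun x hx =>
    if_neg fun ha => Finset.disjoint_left.1 h₁ ha hx
  have hA : ∀ a ∈ A, F a = f a := fun a ha => if_pos ha
  have hne : ∀ a ∈ A, ∀ x ∈ X, f a ≠ q x := fun a ha x hx he =>
    Finset.disjoint_left.1 h₂ (mem_image_of_mem f ha) (he ▸ mem_image_of_mem q hx)
  have hinj : Set.InjOn F (A ∪ X : Finset V) := by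
    intro u hu v hv huv
    rw [mem_coe, mem_union] at hu hv
    rcases hu with hu | hu <;> rcases hv with hv | hv
    · exact f.injective (by rwa [hA u hu, hA v hv] at huv)
    · exact absurd (by rwa [hA u hu, hX v hv] at huv) (hne u hu v hv)
    · exact absurd (by rwa [hX u hu, hA v hv, eq_comm] at huv) (hne v hv u hu)
    · exact q.injective (by rwa [hX u hu, hX v hv] at huv)
  obtain ⟨g, hg⟩ := Finset.exists_equiv_extend_of_card_eq (t := (univ : Finset V)) (by simp)
    (s := A ∪ X) (f := F) (by simp) hinj
  refine ⟨g.trans (Equiv.subtypeUnivEquiv fun x => mem_univ x), fun a ha => ?_, fun x hx => ?_⟩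
  · exact (hg a (mem_union_left _ ha)).trans (hA a ha)
  · exact (hg x (mem_union_right _ hx)).trans (hX x hx)

/-- In terms of falling factorials this is `(N - a)_x ≤ (N)_x`, compared factor by factor. -/
theorem factorial_sub_mul_factorial_sub_le {N a x : ℕ} (h : a + x ≤ N) :
    (N - a).factorial * (N - x).factorial ≤ N.factorial * (N - (a + x)).factorial := by
  induction x with
  | zero => simp [mul_comm]
  | succ x ih =>
    have h1 := ih (by omega)
    obtain ⟨m, rfl⟩ : ∃ m, N = a + x + 1 + m := ⟨N - (a + x + 1), by omega⟩
    rw [show a + x + 1 + m - a = x + 1 + m by omega,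
      show a + x + 1 + m - x = (a + m) + 1 by omega,
      show a + x + 1 + m - (a + x) = m + 1 by omega, Nat.factorial_succ (a + m),
      Nat.factorial_succ m] at h1
    rw [show a + x + 1 + m - a = x + 1 + m by omega,
      show a + x + 1 + m - (x + 1) = a + m by omega,
      show a + x + 1 + m - (a + (x + 1)) = m by omega]
    refine Nat.le_of_mul_le_mul_left (c := m + 1) ?_ (by omega)
    calc (m + 1) * ((x + 1 + m).factorial * (a + m).factorial)
        ≤ (a + m + 1) * ((x + 1 + m).factorial * (a + m).factorial) :=
          Nat.mul_le_mul_right _ (by omega)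
      _ = (x + 1 + m).factorial * ((a + m + 1) * (a + m).factorial) := by ring
      _ ≤ _ := h1
      _ = _ := by ring

/-- For a uniform permutation, compatible prescriptions on disjoint sets are positively correlated:
values already used make each remaining one likelier. -/
theorem card_perm_eqOn_mul_le {V : Type*} [Fintype V] [DecidableEq V] (f q : Perm V)
    (A X : Finset V) (h₁ : Disjoint A X) (h₂ : Disjoint (A.image f) (X.image q)) :
    #{g : Perm V | ∀ a ∈ A, g a = f a} * #{g : Perm V | ∀ x ∈ X, g x = q x} ≤
      Fintype.card (Perm V) * #{g : Perm V | (∀ a ∈ A, g a = f a) ∧ ∀ x ∈ X, g x = q x} := by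
  obtain ⟨g₀, hA, hX⟩ := exists_perm_extend f q A X h₁ h₂
  have : ({g : Perm V | (∀ a ∈ A, g a = f a) ∧ ∀ x ∈ X, g x = q x} : Finset (Perm V)) =
      ({g : Perm V | ∀ a ∈ A ∪ X, g a = g₀ a} : Finset (Perm V)) := by
    ext g
    simp only [mem_filter, mem_univ, true_and, mem_union, or_imp, forall_and]
    refine and_congr (forall₂_congr fun a ha => ?_) (forall₂_congr fun a ha => ?_)
    · rw [hA a ha]
    · rw [hX a ha]
  rw [this, card_perm_eqOn, card_perm_eqOn, card_perm_eqOn, card_union_of_disjoint h₁,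
    Fintype.card_perm]
  refine factorial_sub_mul_factorial_sub_le ?_
  rw [← card_union_of_disjoint h₁]
  exact card_le_univ _

/-! ### Equal versus independent permutations -/

section Diagonal

variable {V : Type*} [DecidableEq V]

/-- The restriction of `f` to `A`, as a partial function. -/
def restrictTo (A : Finset V) (f : Perm V) : V → Option V :=
  fun v => if v ∈ A then some (f v) else none

theorem restrictTo_congr {A B : Finset V} {f g : Perm V} (hAB : B = A)
    (h : ∀ a ∈ A, g a = f a) : restrictTo B g = restrictTo A f := by
  subst hAB
  funext v
  unfold restrictTo
  split_ifs with hv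
  · rw [h v hv]
  · rfl

theorem eq_of_restrictTo_eq {A B : Finset V} {f g : Perm V}
    (h : restrictTo B g = restrictTo A f) (a : V) (ha : a ∈ A) : g a = f a := by
  have := congrFun h a
  unfold restrictTo at this
  rw [if_pos ha] at this
  split_ifs at this
  exact Option.some.inj this

variable [Fintype V] (P : Perm V → Perm V → Prop) (A X : Perm V → Perm V → Finset V)

/-- The points of `f` and of `q` that the interaction visits are disjoint, and so are their
images. -/
def Separated (f q : Perm V) : Prop :=
  Disjoint (A f q) (X f q) ∧ Disjoint ((A f q).image f) ((X f q).image q)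

-- Both sides are split by transcript, the pair of partial functions seen. By `h`, a transcript
-- determines the visited sets and the outcome, so a fibre consists of extensions of partial
-- functions; on separated transcripts positive correlation favours the diagonal.
open Classical in
theorem card_and_separated_le
    (h : ∀ f q f' q', (∀ a ∈ A f q, f' a = f a) → (∀ x ∈ X f q, q' x = q x) →
      A f' q' = A f q ∧ X f' q' = X f q ∧ (P f' q' ↔ P f q)) :
    #{w : Perm V × Perm V | P w.1 w.2 ∧ Separated A X w.1 w.2} ≤
      Fintype.card (Perm V) * #{f : Perm V | P f f} := by
  let c : Perm V × Perm V → (V → Option V) × (V → Option V) := fun w =>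
    (restrictTo (A w.1 w.2) w.1, restrictTo (X w.1 w.2) w.2)
  rw [card_eq_sum_card_fiberwise (f := c) (t := univ) (by simp),
    card_eq_sum_card_fiberwise (s := {f : Perm V | P f f}) (f := fun f => c (f, f)) (t := univ)
      (by simp), mul_sum]
  refine sum_le_sum fun t _ => ?_
  rcases Finset.eq_empty_or_nonempty
    ({w ∈ ({w : Perm V × Perm V | P w.1 w.2 ∧ Separated A X w.1 w.2} : Finset _) | c w = t})
    with he | ⟨⟨f, q⟩, hw⟩
  · rw [he]; simp
  simp only [mem_filter, mem_univ, true_and] at hw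
  obtain ⟨⟨hP, hs₁, hs₂⟩, hc⟩ := hw
  refine le_trans ?_ ((card_perm_eqOn_mul_le f q _ _ hs₁ hs₂).trans
    (Nat.mul_le_mul_left _ (card_le_card ?_)))
  · rw [← card_product]
    refine card_le_card fun w hw => ?_
    simp only [mem_filter, mem_univ, true_and] at hw
    have hcw := hw.2.trans hc.symm
    simp only [mem_product, mem_filter, mem_univ, true_and]
    exact ⟨eq_of_restrictTo_eq (congrArg Prod.fst hcw),
      eq_of_restrictTo_eq (congrArg Prod.snd hcw)⟩
  · intro g hg
    simp only [mem_filter, mem_univ, true_and] at hg ⊢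
    obtain ⟨h1, h2, h3⟩ := h f q g g hg.1 hg.2
    refine ⟨h3.2 hP, hc ▸ ?_⟩
    exact Prod.ext (restrictTo_congr h1 hg.1) (restrictTo_congr h2 hg.2)

open Classical in
/-- An adaptive interaction with two permutations distinguishes two equal uniform permutations
from two independent ones only by a collision of the visited points. -/
theorem card_diagonal_le
    (h : ∀ f q f' q', (∀ a ∈ A f q, f' a = f a) → (∀ x ∈ X f q, q' x = q x) →
      A f' q' = A f q ∧ X f' q' = X f q ∧ (P f' q' ↔ P f q)) :
    Fintype.card (Perm V) * #{f : Perm V | P f f} ≤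
      #{w : Perm V × Perm V | P w.1 w.2} +
        #{w : Perm V × Perm V | ¬ Separated A X w.1 w.2} := by
  -- Separated transcripts bound the diagonal only from below, so the complement of `P` is used to
  -- bound it from above.
  have h1 : #{w : Perm V × Perm V | ¬ P w.1 w.2 ∧ Separated A X w.1 w.2} ≤
      Fintype.card (Perm V) * #{f : Perm V | ¬ P f f} := by
    convert card_and_separated_le (fun f q => ¬ P f q) A X fun f q f' q' ha hx =>
      let ⟨i, j, k⟩ := h f q f' q' ha hx
      ⟨i, j, not_congr k⟩
  have h2 : #{f : Perm V | P f f} + #{f : Perm V | ¬ P f f} = #(univ : Finset (Perm V)) := by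
    convert card_filter_add_card_filter_not (s := (univ : Finset (Perm V))) (fun f => P f f)
  have h3 : #(univ : Finset (Perm V × Perm V)) ≤
      #{w : Perm V × Perm V | P w.1 w.2} +
        #{w : Perm V × Perm V | ¬ Separated A X w.1 w.2} +
        #{w : Perm V × Perm V | ¬ P w.1 w.2 ∧ Separated A X w.1 w.2} := by
    refine (card_le_card fun w _ => ?_).trans ((card_union_le _ _).trans
      (Nat.add_le_add_right (card_union_le _ _) _))
    simp only [mem_union, mem_filter, mem_univ, true_and]
    tauto
  rw [card_univ, Fintype.card_prod] at h3
  rw [card_univ] at h2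
  have h4 := congrArg (Fintype.card (Perm V) * ·) h2
  simp only [mul_add] at h4
  omega

end Diagonal

/-! ### Dependence of a run on the visited points -/

namespace Strategy

theorem run_congr {κ n : ℕ} (s : Strategy κ n) (E E' : CipherPair κ n)
    (p p' : Perm (BitVec n)) (hp : ∀ x ∈ s.onlineSet E p, p' x = p x)
    (hE : ∀ t ∈ s.offlineSet E p, E' t.1 t.2.1 t.2.2 = E t.1 t.2.1 t.2.2) :
    s.run E' p' = s.run E p ∧ s.onlineSet E' p' = s.onlineSet E p ∧
      s.offlineSet E' p' = s.offlineSet E p := by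
  induction s with
  | output b => exact ⟨rfl, rfl, rfl⟩
  | ask q next ih =>
    simp only [onlineSet, offlineSet, mem_union, or_imp, forall_and] at hp hE
    have ih' := ih (q.answer E p) hp.2 hE.2
    have key : q.answer E' p' = q.answer E p ∧ q.online p' = q.online p ∧
        q.offline E' = q.offline E := by
      cases q with
      | enc x => exact ⟨hp.1 x (by simp [Query.online]), rfl, rfl⟩
      | dec y =>
        have : p'.symm y = p.symm y := by
          rw [Equiv.symm_apply_eq, hp.1 _ (by simp [Query.online])]; simp
        simp [Query.answer, Query.online, Query.offline, this]
      | cipher j i a => exact ⟨hE.1 (j, i, a) (by simp [Query.offline]), rfl, rfl⟩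
      | cipherInv j i b =>
        have : (E' j i).symm b = (E j i).symm b := by
          have := hE.1 (j, i, (E j i).symm b) (by simp [Query.offline])
          simp only [Equiv.apply_symm_apply] at this
          rw [Equiv.symm_apply_eq, this]
        simp [Query.answer, Query.online, Query.offline, this]
    simp only [run, onlineSet, offlineSet, key.1, key.2.1, key.2.2, ih'.1, ih'.2.1, ih'.2.2]
    exact ⟨trivial, trivial, trivial⟩

end Strategy

theorem xorPerm_apply {n : ℕ} (z x : BitVec n) : xorPerm z x = z ^^^ x := rfl

theorem xorPerm_mul_self {n : ℕ} (z : BitVec n) : xorPerm z * xorPerm z = 1 := by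
  ext1 x
  simp [xorPerm_apply]

theorem eq_xor_of_xorPerm_eq {n : ℕ} {z x y : BitVec n} (h : xorPerm z x = y) : z = x ^^^ y := by
  rw [← h, xorPerm_apply, BitVec.xor_comm z x, ← BitVec.xor_assoc]
  simp

theorem efx_eq_mul {κ n : ℕ} (E : CipherPair κ n) (k : BitVec κ) (k₁ k₂ : BitVec n) :
    efx E k k₁ k₂ = E 1 k * xorPerm k₂ * E 0 k * xorPerm k₁ := rfl

/-! ### Resampling under the secret key -/

/-- Resampling a component of a uniform object does not change sums over the object. -/
theorem sum_sum_resample {Ω U : Type*} [Fintype Ω] [Fintype U] (get : Ω → U) (set : Ω → U → Ω)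
    (h₁ : ∀ w u, get (set w u) = u) (h₂ : ∀ w, set w (get w) = w)
    (h₃ : ∀ w u v, set (set w u) v = set w v) (φ : Ω → ℕ) :
    ∑ w, ∑ u, φ (set w u) = Fintype.card U * ∑ w, φ w := by
  -- Exchanging the stored component with the fresh one permutes `Ω × U`.
  have e : Function.Involutive fun x : Ω × U => (set x.1 x.2, get x.1) := fun x => by
    simp [h₁, h₂, h₃]
  rw [← Fintype.sum_prod_type' (f := fun w u => φ (set w u)),
    show ∑ x : Ω × U, φ (set x.1 x.2) = ∑ x : Ω × U, φ x.1 from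
      Equiv.sum_comp (e.toPerm _) (fun x : Ω × U => φ x.1), Fintype.sum_prod_type, mul_sum]
  simp

section Keyed

variable {κ n : ℕ}

/-- Replace the two permutations under the key `k`. -/
def setKey (E : CipherPair κ n) (k : BitVec κ) (f g : Perm (BitVec n)) : CipherPair κ n :=
  fun j i => if i = k then (if j = 0 then f else g) else E j i

theorem setKey_zero (E : CipherPair κ n) (k : BitVec κ) (f g : Perm (BitVec n)) :
    setKey E k f g 0 k = f := by simp [setKey]

theorem setKey_one (E : CipherPair κ n) (k : BitVec κ) (f g : Perm (BitVec n)) :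
    setKey E k f g 1 k = g := by simp [setKey]

theorem sum_setKey (k : BitVec κ) (φ : CipherPair κ n → ℕ) :
    ∑ E, ∑ f, ∑ g, φ (setKey E k f g) =
      Fintype.card (Perm (BitVec n)) ^ 2 * ∑ E, φ E := by
  have := sum_sum_resample (U := Perm (BitVec n) × Perm (BitVec n))
    (fun E : CipherPair κ n => (E 0 k, E 1 k)) (fun E u => setKey E k u.1 u.2)
    (fun E u => by simp [setKey])
    (fun E => by
      funext j i
      by_cases hi : i = k
      · subst hi
        fin_cases j <;> simp [setKey]
      · simp [setKey, hi])
    (fun E u v => by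
      funext j i
      by_cases hi : i = k <;> simp [setKey, hi]) φ
  rw [Fintype.card_prod, ← sq] at this
  rw [← this]
  simp only [Fintype.sum_prod_type]

theorem setKey_apply_eq {E : CipherPair κ n} {k : BitVec κ} {f f' g g' : Perm (BitVec n)}
    {t : Fin 2 × BitVec κ × BitVec n}
    (hf : t.1 = 0 → t.2.1 = k → f' t.2.2 = f t.2.2)
    (hg : t.1 = 1 → t.2.1 = k → g' t.2.2 = g t.2.2) :
    setKey E k f' g' t.1 t.2.1 t.2.2 = setKey E k f g t.1 t.2.1 t.2.2 := by
  obtain ⟨j, i, a⟩ := t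
  by_cases hi : i = k
  · fin_cases j
    · simpa [setKey, hi] using hf rfl hi
    · simpa [setKey, hi] using hg rfl hi
  · simp [setKey, hi]

/-- The points at which the cipher `j` is queried under the key `k`. -/
def slice (Q : Finset (Fin 2 × BitVec κ × BitVec n)) (j : Fin 2) (k : BitVec κ) :
    Finset (BitVec n) :=
  {a | (j, k, a) ∈ Q}

theorem mem_slice {Q : Finset (Fin 2 × BitVec κ × BitVec n)} {j : Fin 2} {k : BitVec κ}
    {a : BitVec n} : a ∈ slice Q j k ↔ (j, k, a) ∈ Q := by simp [slice]

theorem mem_slice_of_mem {Q : Finset (Fin 2 × BitVec κ × BitVec n)} {j : Fin 2} {k : BitVec κ}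
    {t : Fin 2 × BitVec κ × BitVec n} (hj : t.1 = j) (hk : t.2.1 = k) (ht : t ∈ Q) :
    t.2.2 ∈ slice Q j k := by
  subst hj hk
  exact mem_slice.2 ht

/-- With the keys `k, k₁, k₂`, a query to the first cipher meets an online query, at its input or,
through the inverse of the second cipher, at its output. -/
def OnlineHit (s : Strategy κ n) (k : BitVec κ) (k₁ k₂ : BitVec n) (E : CipherPair κ n)
    (p : Perm (BitVec n)) : Prop :=
  ∃ w ∈ slice (s.offlineSet E p) 0 k ×ˢ s.onlineSet E p,
    k₁ = w.1 ^^^ w.2 ∨ k₂ = E 0 k w.1 ^^^ (E 1 k).symm (p w.2)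

/-- With the keys `k, k₁, k₂`, queries to the two ciphers meet, at the middle of the construction
or through the encryption oracle. -/
def OfflineHit (s : Strategy κ n) (k : BitVec κ) (k₁ k₂ : BitVec n) (E : CipherPair κ n)
    (p : Perm (BitVec n)) : Prop :=
  ∃ w ∈ slice (s.offlineSet E p) 0 k ×ˢ slice (s.offlineSet E p) 1 k,
    k₁ = w.1 ^^^ p.symm (E 1 k w.2) ∨ k₂ = E 0 k w.1 ^^^ w.2

open Classical in
/-- The indicator of a proposition. -/
noncomputable def ind (P : Prop) : ℕ := if P then 1 else 0

theorem ind_mono {P Q : Prop} (h : P → Q) : ind P ≤ ind Q := by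
  unfold ind
  split_ifs <;> simp_all

theorem sum_ind_diagonal_le {V : Type*} [Fintype V] [DecidableEq V]
    (P : Perm V → Perm V → Prop) (A X : Perm V → Perm V → Finset V)
    (h : ∀ f q f' q', (∀ a ∈ A f q, f' a = f a) → (∀ x ∈ X f q, q' x = q x) →
      A f' q' = A f q ∧ X f' q' = X f q ∧ (P f' q' ↔ P f q)) :
    Fintype.card (Perm V) * ∑ f, ind (P f f) ≤
      ∑ f, ∑ q, (ind (P f q) + ind (¬ Separated A X f q)) := by
  have := card_diagonal_le P A X h
  simp only [card_filter, Fintype.sum_prod_type] at this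
  simp only [ind, sum_add_distrib]
  convert this

theorem not_separated {V : Type*} [DecidableEq V] {A X : Perm V → Perm V → Finset V}
    {f q : Perm V} (h : ¬ Separated A X f q) :
    ∃ a ∈ A f q, ∃ x ∈ X f q, a = x ∨ f a = q x := by
  rw [Separated, not_and_or, Finset.not_disjoint_iff, Finset.not_disjoint_iff] at h
  rcases h with ⟨a, ha, hx⟩ | ⟨y, ha, hx⟩
  · exact ⟨a, ha, a, hx, Or.inl rfl⟩
  · obtain ⟨a, ha', rfl⟩ := mem_image.1 ha
    obtain ⟨x, hx', he⟩ := mem_image.1 hx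
    exact ⟨a, ha', x, hx', Or.inr he.symm⟩

variable (s : Strategy κ n) (k : BitVec κ) (k₁ k₂ : BitVec n)

theorem onlineHit_diagonal (E : CipherPair κ n) (g : Perm (BitVec n)) :
    Fintype.card (Perm (BitVec n)) *
        ∑ f, ind (s.run (setKey E k f g) (efx (setKey E k f g) k k₁ k₂)) ≤
      ∑ f, ∑ p, (ind (s.run (setKey E k f g) p) +
        ind (OnlineHit s k k₁ k₂ (setKey E k f g) p)) := by
  -- `π f` is EFX itself, while for `q` independent of `f` the oracle `π q` is uniform and
  -- independent of `f`.
  let π : Perm (BitVec n) → Perm (BitVec n) := fun q => g * xorPerm k₂ * q * xorPerm k₁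
  have hπ : ∀ q x, π q x = g (xorPerm k₂ (q (xorPerm k₁ x))) := fun q x => rfl
  have hx : ∀ x, xorPerm k₁ (xorPerm k₁ x) = x := fun x => by simp [xorPerm_apply]
  let A : Perm (BitVec n) → Perm (BitVec n) → Finset (BitVec n) := fun f q =>
    slice (s.offlineSet (setKey E k f g) (π q)) 0 k
  let X : Perm (BitVec n) → Perm (BitVec n) → Finset (BitVec n) := fun f q =>
    (s.onlineSet (setKey E k f g) (π q)).image (xorPerm k₁)
  have key := sum_ind_diagonal_le (fun f q => s.run (setKey E k f g) (π q) = true) A X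
    (fun f q f' q' hf hq => by
      obtain ⟨h1, h2, h3⟩ := s.run_congr (setKey E k f g) (setKey E k f' g) (π q) (π q')
        (fun x hx' => by rw [hπ, hπ, hq _ (mem_image_of_mem _ hx')])
        (fun t ht => setKey_apply_eq
          (fun h0 hk => hf _ (mem_slice_of_mem h0 hk ht)) fun _ _ => rfl)
      simp only [A, X, h1, h2, h3, and_self])
  have hreal : ∀ f, efx (setKey E k f g) k k₁ k₂ = π f := fun f => by
    rw [efx_eq_mul, setKey_zero, setKey_one]
  simp only [hreal]
  refine key.trans (sum_le_sum fun f _ => ?_)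
  have hsurj : ∑ p, (ind (s.run (setKey E k f g) p) +
        ind (OnlineHit s k k₁ k₂ (setKey E k f g) p)) =
      ∑ q, (ind (s.run (setKey E k f g) (π q)) +
        ind (OnlineHit s k k₁ k₂ (setKey E k f g) (π q))) :=
    (((Equiv.mulLeft (g * xorPerm k₂)).trans (Equiv.mulRight (xorPerm k₁))).sum_comp _).symm
  rw [hsurj]
  refine sum_le_sum fun q _ => Nat.add_le_add_left (ind_mono fun h => ?_) _
  obtain ⟨a, ha, x', hx', h⟩ := not_separated h
  obtain ⟨x, hxm, rfl⟩ := mem_image.1 hx'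
  refine ⟨(a, x), mem_product.2 ⟨ha, hxm⟩, ?_⟩
  rw [setKey_zero, setKey_one, hπ, Equiv.symm_apply_apply]
  refine h.imp (fun h => ?_) fun h => ?_
  · exact (eq_xor_of_xorPerm_eq h.symm).trans (BitVec.xor_comm _ _)
  · rw [h]
    exact eq_xor_of_xorPerm_eq rfl

theorem offlineHit_diagonal (E : CipherPair κ n) (p : Perm (BitVec n)) :
    Fintype.card (Perm (BitVec n)) *
        ∑ f, ind (s.run (setKey E k f (p * xorPerm k₁ * f⁻¹ * xorPerm k₂)) p) ≤
      ∑ f, ∑ g, (ind (s.run (setKey E k f g) p) +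
        ind (OfflineHit s k k₁ k₂ (setKey E k f g) p)) := by
  let γ : Perm (BitVec n) → Perm (BitVec n) := fun q => p * xorPerm k₁ * q⁻¹ * xorPerm k₂
  have hγ : ∀ q x, γ q x = p (xorPerm k₁ (q⁻¹ (xorPerm k₂ x))) := fun q x => rfl
  let A : Perm (BitVec n) → Perm (BitVec n) → Finset (BitVec n) := fun f q =>
    slice (s.offlineSet (setKey E k f (γ q)) p) 0 k
  let X : Perm (BitVec n) → Perm (BitVec n) → Finset (BitVec n) := fun f q =>
    -- A query `b` to the second cipher reads `q` backwards at `k₂ ⊕ b`; the visited point is the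
    -- resulting input of `q`.
    (slice (s.offlineSet (setKey E k f (γ q)) p) 1 k).image (fun b => q⁻¹ (xorPerm k₂ b))
  have key := sum_ind_diagonal_le (fun f q => s.run (setKey E k f (γ q)) p = true) A X
    (fun f q f' q' hf hq => by
      have hq' : ∀ b ∈ slice (s.offlineSet (setKey E k f (γ q)) p) 1 k,
          q'⁻¹ (xorPerm k₂ b) = q⁻¹ (xorPerm k₂ b) := fun b hb => by
        rw [Perm.inv_eq_iff_eq, hq _ (mem_image_of_mem _ hb)]
        simp
      obtain ⟨h1, h2, h3⟩ := s.run_congr (setKey E k f (γ q)) (setKey E k f' (γ q')) p p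
        (fun _ _ => rfl)
        (fun t ht => setKey_apply_eq
          (fun h0 hk => hf _ (mem_slice_of_mem h0 hk ht))
          (fun h0 hk => by
            rw [hγ, hγ, hq' _ (mem_slice_of_mem h0 hk ht)]))
      simp only [A, X, h1, h3, true_and, and_true]
      exact image_congr hq')
  refine key.trans (sum_le_sum fun f _ => ?_)
  have hsurj : ∑ g, (ind (s.run (setKey E k f g) p) +
        ind (OfflineHit s k k₁ k₂ (setKey E k f g) p)) =
      ∑ q, (ind (s.run (setKey E k f (γ q)) p) +
        ind (OfflineHit s k k₁ k₂ (setKey E k f (γ q)) p)) :=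
    (((Equiv.inv (Perm (BitVec n))).trans ((Equiv.mulLeft (p * xorPerm k₁)).trans
      (Equiv.mulRight (xorPerm k₂)))).sum_comp _).symm
  rw [hsurj]
  refine sum_le_sum fun q _ => Nat.add_le_add_left (ind_mono fun h => ?_) _
  obtain ⟨a, ha, x', hx', h⟩ := not_separated h
  obtain ⟨b, hb, rfl⟩ := mem_image.1 hx'
  refine ⟨(a, b), mem_product.2 ⟨ha, hb⟩, ?_⟩
  rw [setKey_zero, setKey_one, hγ, Equiv.symm_apply_apply]
  refine h.imp (fun h => ?_) fun h => ?_
  · rw [h]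
    exact eq_xor_of_xorPerm_eq rfl
  · rw [show q (q⁻¹ (xorPerm k₂ b)) = xorPerm k₂ b by simp] at h
    exact (eq_xor_of_xorPerm_eq h.symm).trans (BitVec.xor_comm _ _)

theorem card_perm_pos : 0 < Fintype.card (Perm (BitVec n)) ^ 2 :=
  pow_pos Fintype.card_pos 2

theorem sum_run_le_onlineHit :
    Fintype.card (Perm (BitVec n)) *
        ∑ E : CipherPair κ n, ind (s.run E (efx E k k₁ k₂)) ≤
      ∑ E : CipherPair κ n, ∑ p, (ind (s.run E p) + ind (OnlineHit s k k₁ k₂ E p)) := by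
  refine Nat.le_of_mul_le_mul_left ?_ (card_perm_pos (n := n))
  rw [mul_left_comm, ← sum_setKey k (fun E => ind (s.run E (efx E k k₁ k₂))),
    ← sum_setKey k, mul_sum]
  refine sum_le_sum fun E _ => ?_
  rw [sum_comm, mul_sum, sum_comm (s := univ) (t := univ) (f := fun f g => ∑ p, _)]
  exact sum_le_sum fun g _ => onlineHit_diagonal s k k₁ k₂ E g

theorem sum_run_le_offlineHit :
    Fintype.card (Perm (BitVec n)) *
        ∑ E : CipherPair κ n, ind (s.run E (efx E k k₁ k₂)) ≤
      ∑ E : CipherPair κ n, ∑ p, (ind (s.run E p) + ind (OfflineHit s k k₁ k₂ E p)) := by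
  refine Nat.le_of_mul_le_mul_left ?_ (card_perm_pos (n := n))
  rw [mul_left_comm, ← sum_setKey k (fun E => ind (s.run E (efx E k k₁ k₂))),
    ← sum_setKey k, mul_sum]
  refine sum_le_sum fun E _ => ?_
  -- For fixed `f`, EFX depends bijectively on the second permutation. Taking its value `p` as the
  -- summation variable turns the second permutation into `γ f`.
  have hreal : ∀ f : Perm (BitVec n),
      ∑ g, ind (s.run (setKey E k f g) (efx (setKey E k f g) k k₁ k₂)) =
      ∑ p, ind (s.run (setKey E k f (p * xorPerm k₁ * f⁻¹ * xorPerm k₂)) p) := fun f => by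
    rw [← Equiv.sum_comp (Equiv.mulRight (xorPerm k₁ * f⁻¹ * xorPerm k₂))
      (fun g => ind (s.run (setKey E k f g) (efx (setKey E k f g) k k₁ k₂)))]
    refine sum_congr rfl fun p _ => ?_
    have : efx (setKey E k f (p * (xorPerm k₁ * f⁻¹ * xorPerm k₂))) k k₁ k₂ = p := by
      rw [efx_eq_mul, setKey_zero, setKey_one]
      have h2 := xorPerm_mul_self k₂
      calc p * (xorPerm k₁ * f⁻¹ * xorPerm k₂) * xorPerm k₂ * f * xorPerm k₁
          = p * xorPerm k₁ * f⁻¹ * (xorPerm k₂ * xorPerm k₂) * f * xorPerm k₁ := by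
            simp only [mul_assoc]
        _ = p := by rw [h2]; simp [mul_assoc, xorPerm_mul_self]
    rw [Equiv.coe_mulRight, this]
    simp only [mul_assoc]
  simp only [hreal]
  rw [sum_comm, mul_sum]
  have hswap : ∑ f, ∑ g, ∑ p, (ind (s.run (setKey E k f g) p) +
        ind (OfflineHit s k k₁ k₂ (setKey E k f g) p)) =
      ∑ p, ∑ f, ∑ g, (ind (s.run (setKey E k f g) p) +
        ind (OfflineHit s k k₁ k₂ (setKey E k f g) p)) := by
    symm
    rw [sum_comm]
    exact sum_congr rfl fun f _ => sum_comm
  rw [hswap]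
  exact sum_le_sum fun p _ => offlineHit_diagonal s k k₁ k₂ E p

end Keyed

/-! ### Probability of a hit over the keys -/

/-- Union bound: each `w` excludes one row and one column of the square of key pairs. -/
theorem card_hit_le {V ι : Type*} [Fintype V] (W : Finset ι) (φ ψ : ι → V) :
    ∑ k₁, ∑ k₂, ind (∃ w ∈ W, k₁ = φ w ∨ k₂ = ψ w) ≤ 2 * Fintype.card V * #W := by
  classical
  have h : ∀ k₁ k₂, ind (∃ w ∈ W, k₁ = φ w ∨ k₂ = ψ w) ≤
      ∑ w ∈ W, ((if k₁ = φ w then 1 else 0) + if k₂ = ψ w then 1 else 0) := fun k₁ k₂ => by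
    unfold ind
    split_ifs with hw
    · obtain ⟨w, hw, h⟩ := hw
      refine le_trans ?_ (single_le_sum (fun _ _ => Nat.zero_le _) hw)
      rcases h with h | h <;> simp [h]
    · exact Nat.zero_le _
  refine (sum_le_sum fun k₁ _ => sum_le_sum fun k₂ _ => h k₁ k₂).trans (le_of_eq ?_)
  rw [sum_congr rfl fun k₁ _ => sum_comm, sum_comm]
  simp only [sum_add_distrib, sum_const, sum_ite_eq', mem_univ, if_true, card_univ,
    smul_eq_mul, ← mul_sum]
  ring

section Counting

variable {κ n : ℕ}

theorem card_bitVec (m : ℕ) : Fintype.card (BitVec m) = 2 ^ m :=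
  (Fintype.card_congr ⟨BitVec.toFin, BitVec.ofFin, fun _ => rfl, fun _ => rfl⟩).trans
    (Fintype.card_fin _)

theorem sum_card_slice (Q : Finset (Fin 2 × BitVec κ × BitVec n)) :
    ∑ k, (#(slice Q 0 k) + #(slice Q 1 k)) = #Q := by
  have : #Q = ∑ t : Fin 2 × BitVec κ × BitVec n, if t ∈ Q then 1 else 0 := by simp
  rw [this, Fintype.sum_prod_type, Fin.sum_univ_two, Fintype.sum_prod_type,
    Fintype.sum_prod_type, ← sum_add_distrib]
  simp only [slice, card_filter]

variable (s : Strategy κ n) (E : CipherPair κ n) (p : Perm (BitVec n))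

theorem sum_onlineHit_le {D T : ℕ} (hD : #(s.onlineSet E p) ≤ D)
    (hT : #(s.offlineSet E p) ≤ T) :
    ∑ k, ∑ k₁, ∑ k₂, ind (OnlineHit s k k₁ k₂ E p) ≤ 2 * 2 ^ n * (D * T) := by
  refine (sum_le_sum fun k _ => card_hit_le _ _ _).trans ?_
  rw [← mul_sum, card_bitVec]
  refine Nat.mul_le_mul_left _ ?_
  simp only [card_product]
  rw [← sum_mul, mul_comm D]
  refine Nat.mul_le_mul (le_trans ?_ hT) hD
  rw [← sum_card_slice]
  exact sum_le_sum fun k _ => Nat.le_add_right _ _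

/-- With `N = 2^n` and `a`, `b` queries under `k`, the hit count is at most `2Nab` and at most `N²`.
The geometric mean of these bounds is at most `N^(3/2) (a + b)`, which is linear in the queries and
so sums over `k`. -/
theorem sum_offlineHit_le {T : ℕ} (hT : #(s.offlineSet E p) ≤ T) :
    ∑ k, ∑ k₁, ∑ k₂, (ind (OfflineHit s k k₁ k₂ E p) : ℝ) ≤ 2 ^ n * √(2 ^ n) * T := by
  have hN : (0 : ℝ) ≤ 2 ^ n := by positivity
  have hkey : ∀ k, ∑ k₁, ∑ k₂, (ind (OfflineHit s k k₁ k₂ E p) : ℝ) ≤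
      2 ^ n * √(2 ^ n) *
        ((#(slice (s.offlineSet E p) 0 k) + #(slice (s.offlineSet E p) 1 k) : ℕ) : ℝ) := by
    intro k
    set a := #(slice (s.offlineSet E p) 0 k)
    set b := #(slice (s.offlineSet E p) 1 k)
    have h1 : ∑ k₁, ∑ k₂, (ind (OfflineHit s k k₁ k₂ E p) : ℝ) ≤ 2 * 2 ^ n * (a * b) := by
      have := card_hit_le (slice (s.offlineSet E p) 0 k ×ˢ slice (s.offlineSet E p) 1 k)
        (fun w => w.1 ^^^ p.symm (E 1 k w.2)) (fun w => E 0 k w.1 ^^^ w.2)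
      rw [card_bitVec, card_product] at this
      exact_mod_cast this
    have h2 : ∑ k₁, ∑ k₂, (ind (OfflineHit s k k₁ k₂ E p) : ℝ) ≤ 2 ^ n * 2 ^ n := by
      calc _ ≤ ∑ k₁ : BitVec n, ∑ k₂ : BitVec n, (1 : ℝ) := by
            refine sum_le_sum fun k₁ _ => sum_le_sum fun k₂ _ => ?_
            unfold ind
            split_ifs <;> simp
        _ = _ := by simp only [sum_const, card_univ, card_bitVec, nsmul_eq_mul]; simp
    set H := ∑ k₁, ∑ k₂, (ind (OfflineHit s k k₁ k₂ E p) : ℝ)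
    have hH : 0 ≤ H := sum_nonneg fun _ _ => sum_nonneg fun _ _ => Nat.cast_nonneg _
    refine abs_le_of_sq_le_sq' ?_ (by positivity) |>.2
    calc H ^ 2 = H * H := sq H
      _ ≤ (2 ^ n * 2 ^ n) * (2 * 2 ^ n * (a * b)) := mul_le_mul h2 h1 hH (by positivity)
      _ ≤ (2 ^ n * 2 ^ n) * (2 ^ n * ((a : ℝ) + b) ^ 2) := by
          refine mul_le_mul_of_nonneg_left ?_ (by positivity)
          -- This is `2ab ≤ (a + b)²`.
          nlinarith [mul_nonneg hN (add_nonneg (sq_nonneg (a : ℝ)) (sq_nonneg (b : ℝ)))]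
      _ = _ := by
          rw [mul_pow, mul_pow, Real.sq_sqrt hN]
          push_cast
          ring
  refine (sum_le_sum fun k _ => hkey k).trans ?_
  rw [← mul_sum, ← Nat.cast_sum, sum_card_slice]
  gcongr

/-- The probability that the strategy outputs `1` in the real world. -/
noncomputable def realProb (s : Strategy κ n) : ℝ :=
  (∑ E : CipherPair κ n, ∑ k, ∑ k₁, ∑ k₂, (ind (s.run E (efx E k k₁ k₂)) : ℝ)) /
    (Fintype.card (CipherPair κ n) * (2 ^ κ * 2 ^ n * 2 ^ n))

/-- The probability that the strategy outputs `1` in the ideal world. -/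
noncomputable def idealProb (s : Strategy κ n) : ℝ :=
  (∑ E : CipherPair κ n, ∑ p, (ind (s.run E p) : ℝ)) /
    (Fintype.card (CipherPair κ n) * Fintype.card (Perm (BitVec n)))

theorem idealProb_nonneg : 0 ≤ idealProb s := by unfold idealProb; positivity

/-- If the real world can be told from the ideal one only through an event that has, for all
oracles, probability at most `ε` over the keys, then the two probabilities differ by at most
`ε`. -/
theorem realProb_le_of_hit
    (Hit : BitVec κ → BitVec n → BitVec n → CipherPair κ n → Perm (BitVec n) → Prop) (ε : ℝ)
    (h₁ : ∀ k k₁ k₂, Fintype.card (Perm (BitVec n)) *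
        ∑ E : CipherPair κ n, ind (s.run E (efx E k k₁ k₂)) ≤
      ∑ E : CipherPair κ n, ∑ p, (ind (s.run E p) + ind (Hit k k₁ k₂ E p)))
    (h₂ : ∀ E p, ∑ k, ∑ k₁, ∑ k₂, (ind (Hit k k₁ k₂ E p) : ℝ) ≤ ε * (2 ^ κ * 2 ^ n * 2 ^ n)) :
    realProb s ≤ idealProb s + ε := by
  set M : ℝ := (Fintype.card (Perm (BitVec n)) : ℝ)
  set C : ℝ := (Fintype.card (CipherPair κ n) : ℝ)
  have hM : 0 < M := Nat.cast_pos.2 Fintype.card_pos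
  have hC : 0 < C := Nat.cast_pos.2 Fintype.card_pos
  set R := ∑ E : CipherPair κ n, ∑ k, ∑ k₁, ∑ k₂, (ind (s.run E (efx E k k₁ k₂)) : ℝ)
  set I := ∑ E : CipherPair κ n, ∑ p, (ind (s.run E p) : ℝ)
  have hR : R = ∑ k, ∑ k₁, ∑ k₂, ∑ E : CipherPair κ n,
      (ind (s.run E (efx E k k₁ k₂)) : ℝ) := by
    refine sum_comm.trans (sum_congr rfl fun k _ => ?_)
    refine sum_comm.trans (sum_congr rfl fun k₁ _ => sum_comm)
  have hB : ∑ k, ∑ k₁, ∑ k₂, ∑ E : CipherPair κ n, ∑ p, (ind (Hit k k₁ k₂ E p) : ℝ) =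
      ∑ E : CipherPair κ n, ∑ p, ∑ k, ∑ k₁, ∑ k₂, (ind (Hit k k₁ k₂ E p) : ℝ) := by
    symm
    simp_rw [← Fintype.sum_prod_type' (f := fun (E : CipherPair κ n) p => _)]
    refine sum_comm.trans (sum_congr rfl fun k _ => ?_)
    refine sum_comm.trans (sum_congr rfl fun k₁ _ => sum_comm)
  have hmain : M * R ≤ (2 ^ κ * 2 ^ n * 2 ^ n) * I + C * M * (ε * (2 ^ κ * 2 ^ n * 2 ^ n)) := by
    calc M * R = ∑ k, ∑ k₁, ∑ k₂, M * ∑ E : CipherPair κ n,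
          (ind (s.run E (efx E k k₁ k₂)) : ℝ) := by simp_rw [hR, mul_sum]
      _ ≤ ∑ k : BitVec κ, ∑ k₁ : BitVec n, ∑ k₂ : BitVec n,
          (I + ∑ E : CipherPair κ n, ∑ p, (ind (Hit k k₁ k₂ E p) : ℝ)) := by
          refine sum_le_sum fun k _ => sum_le_sum fun k₁ _ => sum_le_sum fun k₂ _ => ?_
          have := h₁ k k₁ k₂
          simp only [sum_add_distrib] at this
          have := (Nat.cast_le (α := ℝ)).2 this
          push_cast at this
          exact this
      _ = (2 ^ κ * 2 ^ n * 2 ^ n) * I + ∑ E : CipherPair κ n, ∑ p,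
          ∑ k, ∑ k₁, ∑ k₂, (ind (Hit k k₁ k₂ E p) : ℝ) := by
          rw [← hB]
          simp only [sum_add_distrib, sum_const, card_univ, card_bitVec, nsmul_eq_mul]
          push_cast
          ring
      _ ≤ _ := by
          gcongr
          refine (sum_le_sum fun E _ => sum_le_sum fun p _ => h₂ E p).trans (le_of_eq ?_)
          simp only [sum_const, card_univ, nsmul_eq_mul]
          ring
  change R / (C * (2 ^ κ * 2 ^ n * 2 ^ n)) ≤ I / (C * M) + ε
  rw [div_add' _ _ _ (by positivity), div_le_div_iff₀ (by positivity) (by positivity)]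
  nlinarith

theorem realProb_le_of_online {D T : ℕ}
    (h : ∀ E p, #(s.onlineSet E p) ≤ D ∧ #(s.offlineSet E p) ≤ T) :
    realProb s ≤ idealProb s + 2 * (D * T) / 2 ^ (κ + n) := by
  refine realProb_le_of_hit s (OnlineHit s) _ (sum_run_le_onlineHit s) fun E p => ?_
  have := sum_onlineHit_le s E p (h E p).1 (h E p).2
  have h' : ∑ k, ∑ k₁, ∑ k₂, (ind (OnlineHit s k k₁ k₂ E p) : ℝ) ≤ 2 * 2 ^ n * (D * T) := by
    exact_mod_cast this
  refine h'.trans (le_of_eq ?_)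
  rw [pow_add]
  field_simp

theorem realProb_le_of_offline {T : ℕ} (h : ∀ E p, #(s.offlineSet E p) ≤ T) :
    realProb s ≤ idealProb s + T / (2 ^ κ * √(2 ^ n)) := by
  refine realProb_le_of_hit s (OfflineHit s) _ (sum_run_le_offlineHit s) fun E p => ?_
  refine (sum_offlineHit_le s E p (h E p)).trans (le_of_eq ?_)
  have h2 : √((2 : ℝ) ^ n) * √(2 ^ n) = 2 ^ n := Real.mul_self_sqrt (by positivity)
  have h3 : √((2 : ℝ) ^ n) ≠ 0 := by positivity
  rw [div_mul_eq_mul_div, eq_div_iff (by positivity)]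
  linear_combination (2 ^ n * T * 2 ^ κ : ℝ) * h2

end Counting

/-! ### From deterministic strategies to randomized adversaries -/

namespace Adversary

variable {κ n : ℕ} (A : Adversary κ n)

theorem uniform_bind_apply {α β : Type*} [Fintype α] [Nonempty α] (f : α → PMF β) (b : β)
    (g : α → ℝ) (hg : ∀ a, 0 ≤ g a) (hf : ∀ a, f a b = ENNReal.ofReal (g a)) :
    ((PMF.uniformOfFintype α).bind f) b = ENNReal.ofReal ((∑ a, g a) / Fintype.card α) := by
  rw [PMF.bind_apply, tsum_fintype]
  simp only [PMF.uniformOfFintype_apply, hf]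
  rw [← mul_sum, mul_comm, ENNReal.ofReal_div_of_pos (Nat.cast_pos.2 Fintype.card_pos),
    ENNReal.ofReal_natCast, div_eq_mul_inv, ENNReal.ofReal_sum_of_nonneg fun a _ => hg a]

theorem pure_apply_true (b : Bool) : (PMF.pure b) true = ENNReal.ofReal (ind (b = true)) := by
  cases b <;> simp [ind]

theorem realWorld_true :
    A.realWorld true = ∑' s, A s * ENNReal.ofReal (realProb s) := by
  have : A.realWorld = A.bind fun s =>
      (PMF.uniformOfFintype (CipherPair κ n)).bind fun E =>
        (PMF.uniformOfFintype (BitVec κ × BitVec n × BitVec n)).bind fun key =>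
          PMF.pure (s.run E (efx E key.1 key.2.1 key.2.2)) := by
    -- The strategy is drawn before the oracles, so that the world becomes a mixture of
    -- deterministic runs.
    rw [PMF.bind_comm]
    unfold realWorld
    congr 1
    funext E
    rw [PMF.bind_comm]
    rfl
  rw [this, PMF.bind_apply]
  refine tsum_congr fun s => congrArg _ ?_
  rw [uniform_bind_apply _ _ _ (fun _ => by positivity) fun E => uniform_bind_apply _ _ _
    (fun _ => by positivity) fun key => pure_apply_true _, realProb, ← sum_div, div_div]
  simp only [Fintype.sum_prod_type, Fintype.card_prod, card_bitVec]
  push_cast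
  congr 2
  ring

theorem idealWorld_true :
    A.idealWorld true = ∑' s, A s * ENNReal.ofReal (idealProb s) := by
  have : A.idealWorld = A.bind fun s =>
      (PMF.uniformOfFintype (CipherPair κ n)).bind fun E =>
        (PMF.uniformOfFintype (Perm (BitVec n))).bind fun p => PMF.pure (s.run E p) := by
    rw [PMF.bind_comm]
    unfold idealWorld
    congr 1
    funext E
    rw [PMF.bind_comm]
    rfl
  rw [this, PMF.bind_apply]
  refine tsum_congr fun s => congrArg _ ?_
  rw [uniform_bind_apply _ _ _ (fun _ => by positivity) fun E => uniform_bind_apply _ _ _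
    (fun _ => by positivity) fun p => pure_apply_true _, idealProb, ← sum_div, div_div,
    mul_comm (Fintype.card (CipherPair κ n) : ℝ)]

theorem advantage_le {ε : ℝ} (hε : 0 ≤ ε)
    (h : ∀ s ∈ A.support, realProb s ≤ idealProb s + ε) : A.advantage ≤ ε := by
  have h1 : A.realWorld true ≤ A.idealWorld true + ENNReal.ofReal ε := by
    rw [realWorld_true, idealWorld_true]
    calc _ ≤ ∑' s, (A s * ENNReal.ofReal (idealProb s) + A s * ENNReal.ofReal ε) := by
          refine ENNReal.tsum_le_tsum fun s => ?_
          by_cases hs : s ∈ A.support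
          · rw [← mul_add, ← ENNReal.ofReal_add (idealProb_nonneg s) hε]
            gcongr
            exact h s hs
          · simp [(PMF.apply_eq_zero_iff A s).2 hs]
      _ = _ := by rw [ENNReal.tsum_add, ENNReal.tsum_mul_right, A.tsum_coe, one_mul]
  have h2 := ENNReal.toReal_mono
    (ENNReal.add_ne_top.2 ⟨PMF.apply_ne_top _ _, ENNReal.ofReal_ne_top⟩) h1
  rw [ENNReal.toReal_add (PMF.apply_ne_top _ _) ENNReal.ofReal_ne_top,
    ENNReal.toReal_ofReal hε] at h2
  unfold advantage
  linarith

end Adversary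

end EFXGame

/-! ### The query bounds -/

theorem mainTheorem4 (δ : ℝ) (hδ : 0 < δ) :
    ∃ c : ℝ, 0 < c ∧
      ∀ (κ n D T : ℕ) (A : EFXGame.Adversary κ n),
        A.MakesAtMost D T → δ ≤ A.advantage →
          c * (2 : ℝ) ^ (κ + n) ≤ (D : ℝ) * (T : ℝ) ∧
          c * (2 : ℝ) ^ ((κ : ℝ) + (n : ℝ) / 2) ≤ (T : ℝ) ∧
          (κ = 2 * n → c * (2 : ℝ) ^ (5 * (n : ℝ) / 2) ≤ (T : ℝ)) := by
  -- The factor 2 in the online bound dictates `δ / 2`; the offline bound alone would allow `δ`.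
  refine ⟨δ / 2, by positivity, fun κ n D T A hA hadv => ?_⟩
  have h1 := hadv.trans (A.advantage_le (by positivity) fun s hs =>
    EFXGame.realProb_le_of_online s (hA s hs))
  have h2 := hadv.trans (A.advantage_le (by positivity) fun s hs =>
    EFXGame.realProb_le_of_offline s fun E p => (hA s hs E p).2)
  rw [le_div_iff₀ (by positivity)] at h1 h2
  have hpow : (2 : ℝ) ^ ((κ : ℝ) + (n : ℝ) / 2) = 2 ^ κ * √(2 ^ n) := by
    rw [Real.rpow_add two_pos, Real.rpow_natCast, Real.sqrt_eq_rpow, ← Real.rpow_natCast 2 n,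
      ← Real.rpow_mul zero_le_two]
    ring_nf
  have h3 : δ / 2 * (2 : ℝ) ^ ((κ : ℝ) + (n : ℝ) / 2) ≤ T := by
    rw [hpow]
    have : 0 < (2 : ℝ) ^ κ * √(2 ^ n) := by positivity
    nlinarith
  refine ⟨by linarith, h3, fun hκ => ?_⟩
  convert h3 using 3
  rw [hκ]
  push_cast
  ring
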